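/- Let $d\in\mathbb{N}$, $0\le d_0\le d$, $p\in(0,2]$, $c_p,c_\infty\ge 0$ with $d_0\,c_\infty^p=c_p^p$, $\sigma>0$, $q\in[0,1]$, and let $\alpha\ge 2$ be an integer. Let $S=\{s\in\mathbb{R}^d:\ \|s\|_p\le c_p,\ \|s\|_\infty\le c_\infty\}$, where $\|s\|_p=(\sum_l|s_l|^p)^{1/p}$. For a finite dataset $Y=(y_1,\dots,y_n)$ of vectors in $\mathbb{R}^d$, let $A(Y)=(o_1,\dots,o_d)$ be the random vector $o_l=\sum_{i\in I_l}y_i(l)+e_l$, where, independently over all coordinates $l$, $I_l\subseteq\{1,\dots,n\}$ contains each index independently with probability $q$ and $e_l\sim\mathcal{N}(0,\sigma^2)$ is independent of $I_l$. Given a processing function $F:\mathcal{X}\to\mathbb{R}^d$ and a clipping operator $\mathrm{CP}:\mathbb{R}^d\to S$, coordinate-wise $q$-Poisson sampling maps a dataset $X=(x_1,\dots,x_n)$ in $\mathcal{X}$ to $A(\mathrm{CP}(F(x_1)),\dots,\mathrm{CP}(F(x_n)))$. Two datasets are adjacent if one is obtained from the other by adding one data point (the order of the points is irrelevant). A randomized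 algorithm $M$ is $(\alpha,\epsilon)$-RDP if $D_\alpha(M(X)\|M(X'))\le\epsilon$ for all adjacent $X,X'$, where $D_\alpha(P\|Q)=\frac{1}{\alpha-1}\log\int (dP/dQ)^\alpha\,dQ$ is the Rényi divergence of the output laws. The privacy loss of $s\in S$ is the supremum, over all finite datasets $Y$ of vectors in $S$, of $\max\{D_\alpha(A(Y\cup s)\|A(Y)),\,D_\alpha(A(Y)\|A(Y\cup s))\}$, and a dominating sensitivity is an element of $S$ of maximal privacy loss. Put $$\epsilon(\alpha)=\frac{d_0}{\alpha-1}\log\Big((1-q)^\alpha+\sum_{v=1}^{\alpha}\binom{\alpha}{v}(1-q)^{\alpha-v}q^v e^{\frac{v(v-1)c_\infty^2}{2\sigma^2}}\Big).$$ Then: (1) the vector $(c_\infty,\dots,c_\infty,0,\dots,0)$ with $d_0$ entries $c_\infty$, and every vector obtained from it by permuting its entries and changing their signs, is a dominating sensitivity; if $q>0$ and ($q<1$ or $p<2$), there are no other dominating sensitivities; (2) the privacy loss of the dominating sensitivity equals $\epsilon(\alpha)$; (3) for all $\mathcal{X}$, $F$ and $\mathrm{CP}$ as above, coordinate-wise $q$-Poisson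 sampling is $(\alpha,\epsilon(\alpha))$-RDP; if moreover $\mathrm{CP}(F(x))$ is, up to order and signs of the entries, the vector in (1) for some $x\in\mathcal{X}$, then $\epsilon(\alpha)$ is the least $\epsilon$ for which it is $(\alpha,\epsilon)$-RDP. -/

import Mathlib

open MeasureTheory ProbabilityTheory

noncomputable section

/-- Rényi divergence of order `a > 1`, with values in the extended reals:
`1 / (a - 1) * log ∫ (dP/dQ)^a dQ`, and `⊤` if `P` is not absolutely continuous
with respect to `Q`. -/
def renyiDiv {E : Type*} [MeasurableSpace E] (a : ℝ) (P Q : Measure E) : EReal :=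
  open Classical in
  if P ≪ Q then
    (((a - 1)⁻¹ : ℝ) : EReal) * ENNReal.log (∫⁻ o, (P.rnDeriv Q o) ^ a ∂Q)
  else ⊤

/-- Two datasets are adjacent if one of them is, up to the order of its entries, the other one
with one additional data point. -/
def Adjacent {𝒳 : Type*} (X X' : List 𝒳) : Prop :=
  (∃ x, X'.Perm (x :: X)) ∨ (∃ x, X.Perm (x :: X'))

/-- `(a, ε)`-Rényi differential privacy of a randomized algorithm, which maps each dataset to
the distribution of its output. -/
def IsRDP {𝒳 E : Type*} [MeasurableSpace E] (M : List 𝒳 → Measure E) (a ε : ℝ) : Prop :=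
  ∀ X X' : List 𝒳, Adjacent X X' → renyiDiv a (M X) (M X') ≤ (ε : EReal)

/-- The joint distribution of the internal randomness used for one coordinate: a Poisson sample
of rate `q` of the index set `Fin n` (an independent `q`-coin for every index) and, independently,
a Gaussian noise of mean `0` and variance `σ ^ 2`. -/
def coordinateRandomness (n : ℕ) (q : unitInterval) (σ : ℝ) : Measure ((Fin n → Bool) × ℝ) :=
  (Measure.pi fun _ : Fin n => bernoulliMeasure true false q).prod
    (gaussianReal 0 (σ ^ 2).toNNReal)

/-- The output distribution of private aggregation with coordinate-wise Poisson sampling, run on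
the list `Y` of (already clipped) vectors. For each coordinate `l`, independently, a Poisson sample
of the indices is drawn, the `l`-th coordinates of the sampled vectors are added up, and
Gaussian noise is added. -/
def aggregateCS {d : ℕ} (q : unitInterval) (σ : ℝ) (Y : List (Fin d → ℝ)) :
    Measure (Fin d → ℝ) :=
  (Measure.pi fun _ : Fin d => coordinateRandomness Y.length q σ).map
    fun ω l => (∑ i : Fin Y.length, if (ω l).1 i then Y.get i l else 0) + (ω l).2

/-- Private aggregation with coordinate-wise Poisson sampling: apply the processing function `F`
and the clipping operator `clip` to every data point, then aggregate. -/
def coordinateSampling {𝒳 : Type*} {d : ℕ} (F : 𝒳 → Fin d → ℝ)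
    (clip : (Fin d → ℝ) → (Fin d → ℝ)) (q : unitInterval) (σ : ℝ) (X : List 𝒳) :
    Measure (Fin d → ℝ) :=
  aggregateCS q σ (X.map fun x => clip (F x))

/-- The set of mixed clipping: `‖s‖_p ≤ cp` and `‖s‖_∞ ≤ c`. -/
def mixedBall (d : ℕ) (p cp c : ℝ) : Set (Fin d → ℝ) :=
  {s | (∑ l, |s l| ^ p) ^ (1 / p) ≤ cp ∧ ∀ l, |s l| ≤ c}

/-- The privacy loss (in order-`a` Rényi divergence) that a differing data point with clipped value
`s` can cause: the supremum, over all datasets of vectors in `S` and over both directions,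
of the divergence between the outputs with and without `s`. -/
def privacyLoss {d : ℕ} (q : unitInterval) (σ a : ℝ) (S : Set (Fin d → ℝ)) (s : Fin d → ℝ) :
    EReal :=
  ⨆ (Y : List (Fin d → ℝ)) (_ : ∀ y ∈ Y, y ∈ S),
    max (renyiDiv a (aggregateCS q σ (s :: Y)) (aggregateCS q σ Y))
      (renyiDiv a (aggregateCS q σ Y) (aggregateCS q σ (s :: Y)))

/-- `s` is a dominating sensitivity in `S`: an element of `S` with maximal privacy loss. -/
def IsDominating {d : ℕ} (q : unitInterval) (σ a : ℝ) (S : Set (Fin d → ℝ)) (s : Fin d → ℝ) :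
    Prop :=
  s ∈ S ∧ ∀ t ∈ S, privacyLoss q σ a S t ≤ privacyLoss q σ a S s

/-- The vector `(c, …, c, 0, …, 0)` with `d₀` entries `c`. -/
def spikeVector (d d₀ : ℕ) (c : ℝ) : Fin d → ℝ := fun l => if (l : ℕ) < d₀ then c else 0

/-- `s` is the vector `(c, …, c, 0, …, 0)` up to the order and the signs of its entries. -/
def IsSpikeForm {d : ℕ} (d₀ : ℕ) (c : ℝ) (s : Fin d → ℝ) : Prop :=
  ∃ π : Equiv.Perm (Fin d), ∀ l, |s l| = spikeVector d d₀ c (π l)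

/-- The closed form: `d₀` times the order-`α` bound of the one-dimensional subsampled Gaussian
with sampling rate `q`, noise `σ` and shift `c`. -/
def closedFormRDP (d₀ α : ℕ) (q σ c : ℝ) : ℝ :=
  (d₀ : ℝ) / ((α : ℝ) - 1) *
    Real.log ((1 - q) ^ α + ∑ v ∈ Finset.Icc 1 α, (α.choose v : ℝ) * (1 - q) ^ (α - v) * q ^ v *
      Real.exp ((v : ℝ) * ((v : ℝ) - 1) * c ^ 2 / (2 * σ ^ 2)))

end

noncomputable section

/-! The coordinates are independent, so the output law is a product and `∫ (dP/dQ)^α dQ` factors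
over coordinates; the divergence is a sum of one-dimensional logarithms.

In one coordinate, a data point `y` acts on the density by convolution with `(1 - q) δ_0 + q δ_y`. A
point common to both datasets thus passes both laws through the same kernel, which cannot increase
the moment (joint convexity of `a ^ α / u ^ (α - 1)`). The empty dataset is therefore the worst one.
There, the reflection `x ↦ s - x` exchanges the two Gaussians, and a pointwise inequality between
symmetrized integrands shows that inserting `s` costs at least as much as removing it. The insertion
moment `M s` (`subsampledMoment`) follows from the binomial theorem, so the privacy loss of `s` is
`(α - 1)⁻¹ * ∑ l, log (M (s l))`.

It remains to maximize this sum. `M` is a weighted mean of exponentials of multiples of `s ^ 2`, so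
Jensen for `x ↦ x ^ θ` with `θ = (t / c) ^ 2` gives `log (M t) ≤ θ * log (M c)`, and `θ ≤ (|t| / c)
^ p` since `p ≤ 2`. Summing under the `ℓ_p` constraint yields `d₀ * log (M c)`. Equality forces
every `|s l|` to be `0` or `c`, and then exactly `d₀` of them to be `c`. -/

/-! ### The law of one coordinate and the product form of the output -/

/-- The density of the sum of a Poisson subsample, of rate `q`, of a list of reals and a centred
Gaussian of variance `σ ^ 2`. -/
def mixDensity (q σ : ℝ) : List ℝ → ℝ → ℝ
  | [], x => gaussianPDFReal 0 (σ ^ 2).toNNReal x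
  | y :: ys, x => (1 - q) * mixDensity q σ ys x + q * mixDensity q σ ys (x - y)

theorem measurable_mixDensity (q σ : ℝ) (ys : List ℝ) : Measurable (mixDensity q σ ys) := by
  induction ys with
  | nil => exact measurable_gaussianPDFReal _ _
  | cons y ys ih =>
    have : Measurable fun x => mixDensity q σ ys (x - y) := ih.comp (measurable_id.sub_const y)
    exact (ih.const_mul _).add (this.const_mul _)

theorem mixDensity_pos {q σ : ℝ} (hσ : 0 < σ) (h0 : 0 ≤ q) (h1 : q ≤ 1) (ys : List ℝ) (x : ℝ) :
    0 < mixDensity q σ ys x := by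
  induction ys generalizing x with
  | nil =>
    refine gaussianPDFReal_pos _ _ _ ?_
    simpa using hσ.ne'
  | cons y ys ih =>
    simp only [mixDensity]
    rcases h0.eq_or_lt with rfl | h0
    · simpa using ih x
    · have := mul_pos h0 (ih (x - y))
      have := mul_nonneg (sub_nonneg.2 h1) (ih x).le
      linarith

theorem mixDensity_perm {q σ : ℝ} {ys zs : List ℝ} (h : ys.Perm zs) :
    mixDensity q σ ys = mixDensity q σ zs := by
  induction h with
  | nil => rfl
  | cons y _ ih => funext x; simp only [mixDensity, ih]
  | swap y z l =>
    funext x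
    simp only [mixDensity, sub_right_comm x y z]
    ring
  | trans _ _ ih₁ ih₂ => exact ih₁.trans ih₂

theorem lintegral_bernoulliMeasure (q : unitInterval) (f : Bool → ENNReal) :
    ∫⁻ b, f b ∂(bernoulliMeasure true false q) =
      ENNReal.ofReal q * f true + ENNReal.ofReal (1 - q) * f false := by
  rw [bernoulliMeasure_def]
  simp only [lintegral_add_measure, lintegral_smul_measure, lintegral_dirac]
  rw [ENNReal.ofReal_eq_coe_nnreal q.2.1, ENNReal.ofReal_eq_coe_nnreal (sub_nonneg.2 q.2.2)]
  rfl

theorem measurable_subsetSum_add {m : ℕ} (z : Fin m → ℝ) :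
    Measurable fun ω : (Fin m → Bool) × ℝ => (∑ i, if ω.1 i then z i else 0) + ω.2 := by
  refine Measurable.add (Finset.measurable_sum _ fun i _ => ?_) measurable_snd
  exact (measurable_of_finite (fun b : Bool => if b then z i else 0)).comp
    ((measurable_pi_apply i).comp measurable_fst)

/-- Conditioning on the coin of index `0`. -/
theorem lintegral_coordinateRandomness_succ (q : unitInterval) (σ : ℝ) {n : ℕ}
    (y : Fin (n + 1) → ℝ) {f : ℝ → ENNReal} (hf : Measurable f) :
    ∫⁻ ω, f ((∑ i, if ω.1 i then y i else 0) + ω.2) ∂(coordinateRandomness (n + 1) q σ) =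
      ENNReal.ofReal q * ∫⁻ ω, f ((∑ i : Fin n, if ω.1 i then y i.succ else 0) + ω.2 + y 0)
        ∂(coordinateRandomness n q σ) +
      ENNReal.ofReal (1 - q) * ∫⁻ ω, f ((∑ i : Fin n, if ω.1 i then y i.succ else 0) + ω.2)
        ∂(coordinateRandomness n q σ) := by
  have hm : ∀ (m : ℕ) (z : Fin m → ℝ) (c : ℝ), Measurable fun ω : (Fin m → Bool) × ℝ =>
      f ((∑ i, if ω.1 i then z i else 0) + ω.2 + c) :=
    fun m z c => hf.comp ((measurable_subsetSum_add z).add_const c)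
  have hm' : ∀ (m : ℕ) (z : Fin m → ℝ), Measurable fun ω : (Fin m → Bool) × ℝ =>
      f ((∑ i, if ω.1 i then z i else 0) + ω.2) := fun m z =>
    hf.comp (measurable_subsetSum_add z)
  unfold coordinateRandomness
  rw [lintegral_prod _ (hm' _ _).aemeasurable, lintegral_prod _ (hm' _ _).aemeasurable,
    lintegral_prod _ (hm _ _ _).aemeasurable]
  have e := (measurePreserving_piFinSuccAbove
    (fun _ : Fin (n + 1) => bernoulliMeasure true false q) 0).symm
  rw [← e.lintegral_comp_emb (MeasurableEquiv.measurableEmbedding _),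
    lintegral_prod _ (measurable_of_finite _).aemeasurable, lintegral_bernoulliMeasure]
  congr 2
  · refine lintegral_congr fun b => lintegral_congr fun x => ?_
    simp [Fin.sum_univ_succ, MeasurableEquiv.piFinSuccAbove]
    ring_nf
  · refine lintegral_congr fun b => lintegral_congr fun x => ?_
    simp [Fin.sum_univ_succ, MeasurableEquiv.piFinSuccAbove]

theorem lintegral_coordinateRandomness (q : unitInterval) {σ : ℝ} (hσ : 0 < σ) {n : ℕ}
    (y : Fin n → ℝ) {f : ℝ → ENNReal} (hf : Measurable f) :
    ∫⁻ ω, f ((∑ i, if ω.1 i then y i else 0) + ω.2) ∂(coordinateRandomness n q σ) =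
      ∫⁻ x, ENNReal.ofReal (mixDensity q σ (List.ofFn y) x) * f x := by
  induction n generalizing f with
  | zero =>
    have hv : (σ ^ 2).toNNReal ≠ 0 := by simpa using hσ.ne'
    simp only [coordinateRandomness, Finset.univ_eq_empty, Finset.sum_empty, zero_add,
      List.ofFn_zero, mixDensity]
    rw [lintegral_prod (fun ω : (Fin 0 → Bool) × ℝ => f ω.2)
        (hf.comp measurable_snd).aemeasurable]
    simp only [lintegral_const, measure_univ, mul_one]
    rw [ gaussianReal_of_var_ne_zero _ hv,
      lintegral_withDensity_eq_lintegral_mul _ (measurable_gaussianPDF _ _) hf]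
    rfl
  | succ n ih =>
    have hd := measurable_mixDensity q σ (List.ofFn fun i => y (Fin.succ i))
    -- The hypothesis is used for `f` and for its translate by `y 0`; translation invariance of
    -- Lebesgue measure then moves the shift onto the density, as in the recursion of `mixDensity`.
    rw [lintegral_coordinateRandomness_succ q σ y hf, ih _ hf,
      ih (f := fun x => f (x + y 0)) _ (hf.comp (measurable_add_const (y 0))), List.ofFn_succ,
      ← lintegral_sub_right_eq_self _ (y 0), ← lintegral_const_mul _ (by fun_prop),
      ← lintegral_const_mul _ (by fun_prop), ← lintegral_add_left (by fun_prop)]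
    refine lintegral_congr fun x => ?_
    have h0 := q.2.1
    have h1 : (0 : ℝ) ≤ 1 - q := sub_nonneg.2 q.2.2
    have p := fun x => (mixDensity_pos hσ h0 q.2.2 (List.ofFn fun i => y (Fin.succ i)) x).le
    simp only [mixDensity, sub_add_cancel]
    rw [ENNReal.ofReal_add (mul_nonneg h1 (p _)) (mul_nonneg h0 (p _)), ENNReal.ofReal_mul h1,
      ENNReal.ofReal_mul h0]
    ring

/-- The distribution on `ℝ` with density `mixDensity q σ ys`. -/
def mixLaw (q σ : ℝ) (ys : List ℝ) : Measure ℝ :=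
  volume.withDensity fun x => ENNReal.ofReal (mixDensity q σ ys x)

theorem map_coordinateRandomness (q : unitInterval) {σ : ℝ} (hσ : 0 < σ) {n : ℕ}
    (y : Fin n → ℝ) :
    (coordinateRandomness n q σ).map (fun ω => (∑ i, if ω.1 i then y i else 0) + ω.2) =
      mixLaw q σ (List.ofFn y) := by
  have hd := measurable_mixDensity q σ (List.ofFn y)
  refine Measure.ext_of_lintegral _ fun f hf => ?_
  rw [lintegral_map hf (measurable_subsetSum_add y), lintegral_coordinateRandomness q hσ y hf,
    mixLaw, lintegral_withDensity_eq_lintegral_mul _ hd.ennreal_ofReal hf]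
  rfl

instance (n : ℕ) (q : unitInterval) (σ : ℝ) : IsProbabilityMeasure (coordinateRandomness n q σ) := by
  unfold coordinateRandomness
  infer_instance

theorem isProbabilityMeasure_mixLaw (q : unitInterval) {σ : ℝ} (hσ : 0 < σ) (ys : List ℝ) :
    IsProbabilityMeasure (mixLaw q σ ys) := by
  rw [← List.ofFn_get ys, ← map_coordinateRandomness q hσ]
  exact Measure.isProbabilityMeasure_map (measurable_subsetSum_add _).aemeasurable

theorem aggregateCS_eq_pi {d : ℕ} (q : unitInterval) {σ : ℝ} (hσ : 0 < σ)
    (Y : List (Fin d → ℝ)) :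
    aggregateCS q σ Y = Measure.pi fun l => mixLaw q σ (Y.map fun y => y l) := by
  have e : ∀ l, mixLaw q σ (Y.map fun y => y l) = (coordinateRandomness Y.length q σ).map
      fun ω => (∑ i, if ω.1 i then Y.get i l else 0) + ω.2 := by
    intro l
    rw [map_coordinateRandomness q hσ fun i => Y.get i l]
    congr 1
    conv_lhs => rw [← List.ofFn_get Y, List.map_ofFn]
    rfl
  have (l : Fin d) : SigmaFinite ((coordinateRandomness Y.length q σ).map
      fun ω => (∑ i, if ω.1 i then Y.get i l else 0) + ω.2) := by
    have := isProbabilityMeasure_mixLaw q hσ (Y.map fun y => y l)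
    rw [← e]
    infer_instance
  simp_rw [e]
  exact Measure.pi_map_pi fun l => (measurable_subsetSum_add _).aemeasurable

/-! ### Common data points do not increase the moment -/

/-- The moment `∫ f ^ α / g ^ (α - 1)`, in which the Rényi divergence of order `α` between the
distributions with densities `f` and `g` is expressed. -/
def renyiMoment (α : ℕ) (f g : ℝ → ℝ) : ENNReal :=
  ∫⁻ x, ENNReal.ofReal (f x ^ α / g x ^ (α - 1))

/-- The perspective of `x ^ α` is convex and homogeneous of degree one, hence subadditive: Jensen at
`a / u` and `b / v` with weights `u / (u + v)` and `v / (u + v)`. -/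
theorem add_pow_div_add_pow_le {α : ℕ} (hα : 1 ≤ α) {a b u v : ℝ} (ha : 0 ≤ a) (hb : 0 ≤ b)
    (hu : 0 < u) (hv : 0 < v) :
    (a + b) ^ α / (u + v) ^ (α - 1) ≤ a ^ α / u ^ (α - 1) + b ^ α / v ^ (α - 1) := by
  obtain ⟨n, rfl⟩ := Nat.exists_eq_add_of_le' hα
  have huv : 0 < u + v := add_pos hu hv
  have h : (u / (u + v) * (a / u) + v / (u + v) * (b / v)) ^ (n + 1) ≤
      u / (u + v) * (a / u) ^ (n + 1) + v / (u + v) * (b / v) ^ (n + 1) :=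
    (convexOn_pow (n + 1)).2 (Set.mem_Ici.2 (div_nonneg ha hu.le))
      (Set.mem_Ici.2 (div_nonneg hb hv.le)) (by positivity) (by positivity) (by field_simp)
  have e : u / (u + v) * (a / u) + v / (u + v) * (b / v) = (a + b) / (u + v) := by
    field_simp
  rw [e] at h
  rw [Nat.add_sub_cancel]
  have h2 := mul_le_mul_of_nonneg_left h huv.le
  calc (a + b) ^ (n + 1) / (u + v) ^ n = (u + v) * ((a + b) / (u + v)) ^ (n + 1) := by
        rw [div_pow]
        field_simp
        ring
    _ ≤ _ := h2
    _ = _ := by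
        rw [div_pow, div_pow]
        field_simp
        ring

/-- Data processing for the kernel that adds `y` with probability `q`: the integrand is bounded by
the mixture of its translates, and translates have equal integrals. -/
theorem renyiMoment_mix_le {α : ℕ} (hα : 1 ≤ α) {q : ℝ} (h0 : 0 ≤ q) (h1 : q ≤ 1)
    {f g : ℝ → ℝ} (hf : Measurable f) (hg : Measurable g) (hf0 : ∀ x, 0 ≤ f x)
    (hg0 : ∀ x, 0 < g x) (y : ℝ) :
    renyiMoment α (fun x => (1 - q) * f x + q * f (x - y))
      (fun x => (1 - q) * g x + q * g (x - y)) ≤ renyiMoment α f g := by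
  have h1' : 0 ≤ 1 - q := sub_nonneg.2 h1
  obtain ⟨n, rfl⟩ := Nat.exists_eq_add_of_le' hα
  simp only [renyiMoment, Nat.add_sub_cancel]
  have key : ∀ x, ((1 - q) * f x + q * f (x - y)) ^ (n + 1) /
      ((1 - q) * g x + q * g (x - y)) ^ n ≤
      (1 - q) * (f x ^ (n + 1) / g x ^ n) + q * (f (x - y) ^ (n + 1) / g (x - y) ^ n) := by
    intro x
    -- For `q = 0` or `q = 1` one weight vanishes and the positive denominators of the convexity
    -- bound are lost.
    rcases h0.eq_or_lt with rfl | h0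
    · simp
    rcases h1'.eq_or_lt with h1' | h1'
    · obtain rfl : q = 1 := by linarith
      simp
    have h := add_pow_div_add_pow_le hα (mul_nonneg h1'.le (hf0 x))
      (mul_nonneg h0.le (hf0 (x - y))) (mul_pos h1' (hg0 x)) (mul_pos h0 (hg0 (x - y)))
    rw [Nat.add_sub_cancel] at h
    refine h.trans_eq ?_
    have := (hg0 x).ne'
    have := (hg0 (x - y)).ne'
    rw [mul_pow, mul_pow, mul_pow, mul_pow]
    field_simp
    ring
  have hm : Measurable fun x => f x ^ (n + 1) / g x ^ n := by fun_prop
  calc _ ≤ ∫⁻ x, (ENNReal.ofReal (1 - q) *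
        ENNReal.ofReal (f x ^ (n + 1) / g x ^ n) + ENNReal.ofReal q *
        ENNReal.ofReal (f (x - y) ^ (n + 1) / g (x - y) ^ n)) := by
        refine lintegral_mono fun x => (ENNReal.ofReal_le_ofReal (key x)).trans_eq ?_
        have p : ∀ x, 0 ≤ f x ^ (n + 1) / g x ^ n := fun x =>
          div_nonneg (pow_nonneg (hf0 x) _) (pow_nonneg (hg0 x).le _)
        rw [ENNReal.ofReal_add (mul_nonneg h1' (p _)) (mul_nonneg h0 (p _)),
          ENNReal.ofReal_mul h1', ENNReal.ofReal_mul h0]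
    _ = ENNReal.ofReal (1 - q) * (∫⁻ x, ENNReal.ofReal (f x ^ (n + 1) / g x ^ n)) +
        ENNReal.ofReal q * (∫⁻ x, ENNReal.ofReal (f x ^ (n + 1) / g x ^ n)) := by
        rw [lintegral_add_left (by fun_prop), lintegral_const_mul _ (by fun_prop),
          lintegral_const_mul _ (by fun_prop), lintegral_sub_right_eq_self
          (fun x => ENNReal.ofReal (f x ^ (n + 1) / g x ^ n)) y]
    _ = (∫⁻ x, ENNReal.ofReal (f x ^ (n + 1) / g x ^ n)) := by
        rw [← add_mul, ← ENNReal.ofReal_add h1' h0]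
        simp

theorem mixDensity_cons_comm (q σ : ℝ) (s y : ℝ) (ys : List ℝ) :
    mixDensity q σ (s :: y :: ys) = mixDensity q σ (y :: s :: ys) :=
  mixDensity_perm (List.Perm.swap _ _ _)

theorem renyiMoment_insert_le {α : ℕ} (hα : 1 ≤ α) {q σ : ℝ} (hσ : 0 < σ) (h0 : 0 ≤ q)
    (h1 : q ≤ 1) (s : ℝ) (ys : List ℝ) :
    renyiMoment α (mixDensity q σ (s :: ys)) (mixDensity q σ ys) ≤
      renyiMoment α (mixDensity q σ [s]) (mixDensity q σ []) := by
  induction ys with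
  | nil => exact le_rfl
  | cons y ys ih =>
    refine le_trans ?_ ih
    rw [mixDensity_cons_comm]
    exact renyiMoment_mix_le hα h0 h1 (measurable_mixDensity _ _ _) (measurable_mixDensity _ _ _)
      (fun x => (mixDensity_pos hσ h0 h1 _ x).le) (mixDensity_pos hσ h0 h1 _) y

theorem renyiMoment_remove_le {α : ℕ} (hα : 1 ≤ α) {q σ : ℝ} (hσ : 0 < σ) (h0 : 0 ≤ q)
    (h1 : q ≤ 1) (s : ℝ) (ys : List ℝ) :
    renyiMoment α (mixDensity q σ ys) (mixDensity q σ (s :: ys)) ≤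
      renyiMoment α (mixDensity q σ []) (mixDensity q σ [s]) := by
  induction ys with
  | nil => exact le_rfl
  | cons y ys ih =>
    refine le_trans ?_ ih
    rw [mixDensity_cons_comm]
    exact renyiMoment_mix_le hα h0 h1 (measurable_mixDensity _ _ _) (measurable_mixDensity _ _ _)
      (fun x => (mixDensity_pos hσ h0 h1 _ x).le) (mixDensity_pos hσ h0 h1 _) y

/-! ### Removal costs no more than insertion -/

/-- The geometric sum of `r ^ j` over `-n ≤ j ≤ n`, with `j` and `-j` paired so that each pair
increases in `r ≥ 1`. -/
theorem pow_sub_pow_eq_sub_mul_sum {r : ℝ} (hr : 0 < r) (n : ℕ) :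
    r ^ (n + 1) - (r⁻¹) ^ n =
      (r - 1) * (1 + ∑ j ∈ Finset.range n, (r ^ (j + 1) + (r⁻¹) ^ (j + 1))) := by
  induction n with
  | zero => simp
  | succ n ih =>
    rw [Finset.sum_range_succ, ← add_assoc, mul_add, ← ih]
    have h : r * r⁻¹ ^ (n + 1) = r⁻¹ ^ n := by rw [pow_succ]; field_simp
    linear_combination -h

theorem add_inv_le_add_inv {x y : ℝ} (hx : 1 ≤ x) (hxy : x ≤ y) : x + x⁻¹ ≤ y + y⁻¹ := by
  have hx0 : 0 < x := by linarith
  have hy0 : 0 < y := by linarith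
  have : y + y⁻¹ - (x + x⁻¹) = (y - x) * (x * y - 1) / (x * y) := by field_simp; ring
  have h : 0 ≤ (y - x) * (x * y - 1) / (x * y) :=
    div_nonneg (mul_nonneg (by linarith) (by nlinarith)) (by positivity)
  linarith

/-- With `h r = r ^ (n + 1) - r⁻¹ ^ n`, this is the inequality `h a + w * h (b / w) ≥ 0` for
`a = 1 - q + q * w` and `b = (1 - q) * w + q`. -/
theorem symmetrized_pow_le {q w : ℝ} (h0 : 0 ≤ q) (h1 : q ≤ 1) (hw : 1 ≤ w) (n : ℕ) :
    ((1 - q + q * w)⁻¹) ^ n + w * ((1 - q + q * w⁻¹)⁻¹) ^ n ≤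
      (1 - q + q * w) ^ (n + 1) + w * (1 - q + q * w⁻¹) ^ (n + 1) := by
  have hw0 : 0 < w := by linarith
  set a := 1 - q + q * w with ha
  set b := (1 - q) * w + q with hb
  have ha1 : 1 ≤ a := by nlinarith
  have hb1 : 1 ≤ b := by nlinarith
  have ha0 : 0 < a := by linarith
  have hb0 : 0 < b := by linarith
  set r := w / b with hr
  have hr0 : 0 < r := by positivity
  have e1 : 1 - q + q * w⁻¹ = r⁻¹ := by rw [hr, hb]; field_simp
  have e2 : w = b * r := by rw [hr]; field_simp
  have hr1 : 1 ≤ r := by rw [hr, one_le_div hb0]; nlinarith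
  -- This is `a + b = 1 + w`. With `b ≥ 1` it gives `r ≤ a`, and it makes the linear factors of the
  -- two sides of `key` agree.
  have e3 : b * (r - 1) = a - 1 := by rw [mul_sub, ← e2]; rw [ha, hb]; ring
  have hra : r ≤ a := by nlinarith
  rw [e1, inv_inv]
  have key : b * (r ^ (n + 1) - (r⁻¹) ^ n) ≤ a ^ (n + 1) - (a⁻¹) ^ n := by
    rw [pow_sub_pow_eq_sub_mul_sum hr0, pow_sub_pow_eq_sub_mul_sum ha0, ← mul_assoc, e3]
    refine mul_le_mul_of_nonneg_left ?_ (by linarith)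
    refine add_le_add_right (Finset.sum_le_sum fun j _ => ?_) _
    rw [inv_pow, inv_pow]
    exact add_inv_le_add_inv (one_le_pow₀ hr1) (pow_le_pow_left₀ hr0.le hra _)
  have e4 : w * (r⁻¹) ^ (n + 1) = b * (r⁻¹) ^ n := by
    rw [e2, pow_succ]; field_simp
  have e5 : w * r ^ n = b * r ^ (n + 1) := by
    rw [e2, pow_succ]; ring
  linarith

theorem symmetrized_pow_le' {q w : ℝ} (h0 : 0 ≤ q) (h1 : q ≤ 1) (hw : 0 < w) (n : ℕ) :
    ((1 - q + q * w)⁻¹) ^ n + w * ((1 - q + q * w⁻¹)⁻¹) ^ n ≤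
      (1 - q + q * w) ^ (n + 1) + w * (1 - q + q * w⁻¹) ^ (n + 1) := by
  rcases le_total 1 w with h | h
  · exact symmetrized_pow_le h0 h1 h n
  -- Replacing `w` by `w⁻¹` and multiplying by `w` swaps the two terms on each side.
  · have := mul_le_mul_of_nonneg_left (symmetrized_pow_le h0 h1 (one_le_inv₀ hw |>.2 h) n) hw.le
    rw [inv_inv, mul_add, mul_add, mul_inv_cancel_left₀ hw.ne', mul_inv_cancel_left₀ hw.ne'] at this
    linarith

/-- The likelihood ratio of the Gaussians of variance `σ ^ 2` with means `s` and `0`. -/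
def gaussianRatio (σ s x : ℝ) : ℝ := Real.exp ((2 * s * x - s ^ 2) / (2 * σ ^ 2))

theorem gaussianRatio_pos (σ s x : ℝ) : 0 < gaussianRatio σ s x := Real.exp_pos _

@[fun_prop]
theorem measurable_gaussianRatio (σ s : ℝ) : Measurable (gaussianRatio σ s) := by
  unfold gaussianRatio
  fun_prop

theorem gaussianRatio_sub_self {σ : ℝ} (s x : ℝ) :
    gaussianRatio σ s (s - x) = (gaussianRatio σ s x)⁻¹ := by
  rw [gaussianRatio, gaussianRatio, ← Real.exp_neg]
  ring_nf

/-- Completing the square: tilting by the `v`-th power of the ratio recentres the Gaussian at `v *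
s`. -/
theorem gaussianPDFReal_mul_gaussianRatio_pow {σ : ℝ} (hσ : 0 < σ) (s x : ℝ) (v : ℕ) :
    gaussianPDFReal 0 (σ ^ 2).toNNReal x * gaussianRatio σ s x ^ v =
      Real.exp ((v : ℝ) * ((v : ℝ) - 1) * s ^ 2 / (2 * σ ^ 2)) *
        gaussianPDFReal 0 (σ ^ 2).toNNReal (x - v * s) := by
  rw [gaussianPDFReal, gaussianPDFReal, gaussianRatio, ← Real.exp_nat_mul, mul_assoc,
    ← Real.exp_add, mul_left_comm, ← Real.exp_add, Real.coe_toNNReal _ (sq_nonneg σ)]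
  congr 2
  field_simp
  ring

theorem gaussianPDFReal_sub_eq {σ : ℝ} (hσ : 0 < σ) (s x : ℝ) :
    gaussianPDFReal 0 (σ ^ 2).toNNReal (x - s) =
      gaussianPDFReal 0 (σ ^ 2).toNNReal x * gaussianRatio σ s x := by
  simpa using (gaussianPDFReal_mul_gaussianRatio_pow hσ s x 1).symm

theorem gaussianPDFReal_zero_sub_comm {v : NNReal} (x y : ℝ) :
    gaussianPDFReal 0 v (x - y) = gaussianPDFReal 0 v (y - x) := by
  simp only [gaussianPDFReal, sub_zero, ← neg_sub y x, neg_sq]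

theorem mixDensity_singleton {q σ : ℝ} (hσ : 0 < σ) (s x : ℝ) :
    mixDensity q σ [s] x =
      gaussianPDFReal 0 (σ ^ 2).toNNReal x * (1 - q + q * gaussianRatio σ s x) := by
  simp only [mixDensity, gaussianPDFReal_sub_eq hσ]
  ring

theorem renyiMoment_singleton_nil {q σ : ℝ} (hσ : 0 < σ) (s : ℝ) (n : ℕ) :
    renyiMoment (n + 1) (mixDensity q σ [s]) (mixDensity q σ []) =
      ∫⁻ x, ENNReal.ofReal (gaussianPDFReal 0 (σ ^ 2).toNNReal x *
        (1 - q + q * gaussianRatio σ s x) ^ (n + 1)) := by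
  refine lintegral_congr fun x => ?_
  have := (gaussianPDFReal_pos 0 (σ ^ 2).toNNReal x (by simpa using hσ.ne')).ne'
  rw [mixDensity_singleton hσ, mixDensity, Nat.add_sub_cancel, mul_pow]
  congr 1
  field_simp
  ring

theorem mix_gaussianRatio_pos {q : ℝ} (h0 : 0 ≤ q) (h1 : q ≤ 1) {w : ℝ} (hw : 0 < w) :
    0 < 1 - q + q * w := by
  rcases h0.eq_or_lt with rfl | h0
  · simp
  · have := mul_pos h0 hw
    linarith

theorem renyiMoment_nil_singleton {q σ : ℝ} (hσ : 0 < σ) (h0 : 0 ≤ q) (h1 : q ≤ 1) (s : ℝ)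
    (n : ℕ) :
    renyiMoment (n + 1) (mixDensity q σ []) (mixDensity q σ [s]) =
      ∫⁻ x, ENNReal.ofReal (gaussianPDFReal 0 (σ ^ 2).toNNReal x *
        ((1 - q + q * gaussianRatio σ s x)⁻¹) ^ n) := by
  refine lintegral_congr fun x => ?_
  have := (gaussianPDFReal_pos 0 (σ ^ 2).toNNReal x (by simpa using hσ.ne')).ne'
  have := (mix_gaussianRatio_pos h0 h1 (gaussianRatio_pos σ s x)).ne'
  rw [mixDensity_singleton hσ, mixDensity, Nat.add_sub_cancel, mul_pow, inv_pow]
  congr 1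
  field_simp
  ring

/-- Average over the reflection `x ↦ s - x`, which swaps the Gaussians centred at `0` and `s` and
inverts their ratio. -/
theorem two_mul_lintegral_gaussianRatio {σ : ℝ} (hσ : 0 < σ) (s : ℝ) {G : ℝ → ℝ}
    (hG : Measurable G) (hG0 : ∀ w, 0 < w → 0 ≤ G w) :
    2 * ∫⁻ x, ENNReal.ofReal (gaussianPDFReal 0 (σ ^ 2).toNNReal x * G (gaussianRatio σ s x)) =
      ∫⁻ x, ENNReal.ofReal (gaussianPDFReal 0 (σ ^ 2).toNNReal x *
        (G (gaussianRatio σ s x) + gaussianRatio σ s x * G (gaussianRatio σ s x)⁻¹)) := by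
  have hp := measurable_gaussianPDFReal 0 (σ ^ 2).toNNReal
  have hp0 := gaussianPDFReal_nonneg 0 (σ ^ 2).toNNReal
  have hw := gaussianRatio_pos σ s
  rw [two_mul]
  nth_rewrite 2 [← lintegral_sub_left_eq_self _ s]
  rw [← lintegral_add_left (by fun_prop)]
  refine lintegral_congr fun x => ?_
  rw [gaussianPDFReal_zero_sub_comm s x, gaussianPDFReal_sub_eq hσ, gaussianRatio_sub_self,
    ← ENNReal.ofReal_add (mul_nonneg (hp0 _) (hG0 _ (hw x)))
      (mul_nonneg (mul_nonneg (hp0 _) (hw x).le) (hG0 _ (inv_pos.2 (hw x))))]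
  ring_nf

theorem renyiMoment_nil_singleton_le {α : ℕ} (hα : 1 ≤ α) {q σ : ℝ} (hσ : 0 < σ) (h0 : 0 ≤ q)
    (h1 : q ≤ 1) (s : ℝ) :
    renyiMoment α (mixDensity q σ []) (mixDensity q σ [s]) ≤
      renyiMoment α (mixDensity q σ [s]) (mixDensity q σ []) := by
  obtain ⟨n, rfl⟩ := Nat.exists_eq_add_of_le' hα
  -- The original integrands are not ordered pointwise where the ratio is below `1`; the doubled,
  -- symmetrized ones are.
  rw [renyiMoment_nil_singleton hσ h0 h1, renyiMoment_singleton_nil hσ,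
    ← ENNReal.mul_le_mul_iff_right (a := 2) (by simp) (by simp),
    two_mul_lintegral_gaussianRatio hσ s (G := fun w => ((1 - q + q * w)⁻¹) ^ n) (by fun_prop)
      fun w hw => pow_nonneg (inv_nonneg.2 (mix_gaussianRatio_pos h0 h1 hw).le) _,
    two_mul_lintegral_gaussianRatio hσ s (G := fun w => (1 - q + q * w) ^ (n + 1)) (by fun_prop)
      fun w hw => pow_nonneg (mix_gaussianRatio_pos h0 h1 hw).le _]
  exact lintegral_mono fun x => ENNReal.ofReal_le_ofReal <| mul_le_mul_of_nonneg_left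
    (symmetrized_pow_le' h0 h1 (gaussianRatio_pos σ s x) n) (gaussianPDFReal_nonneg _ _ _)

/-! ### Closed form of the one-dimensional moment -/

/-- The order-`α` moment of the likelihood ratio of a subsampled Gaussian. -/
def subsampledMoment (α : ℕ) (q σ s : ℝ) : ℝ :=
  ∑ v ∈ Finset.range (α + 1), (α.choose v : ℝ) * (1 - q) ^ (α - v) * q ^ v *
    Real.exp ((v : ℝ) * ((v : ℝ) - 1) * s ^ 2 / (2 * σ ^ 2))

/-- Binomial expansion turns the integrand into a combination of translated Gaussian densities, each
of mass one. -/
theorem renyiMoment_singleton_nil_eq {α : ℕ} (hα : 1 ≤ α) {q σ : ℝ} (hσ : 0 < σ) (h0 : 0 ≤ q)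
    (h1 : q ≤ 1) (s : ℝ) :
    renyiMoment α (mixDensity q σ [s]) (mixDensity q σ []) =
      ENNReal.ofReal (subsampledMoment α q σ s) := by
  obtain ⟨n, rfl⟩ := Nat.exists_eq_add_of_le' hα
  have hv : (σ ^ 2).toNNReal ≠ 0 := by simpa using hσ.ne'
  have hp := measurable_gaussianPDFReal 0 (σ ^ 2).toNNReal
  have hp0 := gaussianPDFReal_nonneg 0 (σ ^ 2).toNNReal
  have h1' : 0 ≤ 1 - q := sub_nonneg.2 h1
  have e : ∀ x, ENNReal.ofReal (gaussianPDFReal 0 (σ ^ 2).toNNReal x *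
        (1 - q + q * gaussianRatio σ s x) ^ (n + 1)) =
      ∑ v ∈ Finset.range (n + 1 + 1), ENNReal.ofReal (((n + 1).choose v : ℝ) *
        (1 - q) ^ (n + 1 - v) * q ^ v *
        Real.exp ((v : ℝ) * ((v : ℝ) - 1) * s ^ 2 / (2 * σ ^ 2))) *
        ENNReal.ofReal (gaussianPDFReal 0 (σ ^ 2).toNNReal (x - v * s)) := by
    intro x
    rw [add_comm (1 - q), add_pow, Finset.mul_sum, ENNReal.ofReal_sum_of_nonneg]
    · refine Finset.sum_congr rfl fun v _ => ?_
      rw [← ENNReal.ofReal_mul (by positivity), mul_assoc _ (Real.exp _),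
        ← gaussianPDFReal_mul_gaussianRatio_pow hσ, mul_pow]
      ring_nf
    · intro v _
      have := gaussianRatio_pos σ s x
      have := hp0 x
      positivity
  rw [renyiMoment_singleton_nil hσ]
  simp_rw [e]
  rw [lintegral_finsetSum _ fun v _ => by fun_prop, subsampledMoment,
    ENNReal.ofReal_sum_of_nonneg fun v _ => by positivity]
  refine Finset.sum_congr rfl fun v _ => ?_
  rw [lintegral_const_mul _ (by fun_prop), lintegral_sub_right_eq_self
    (fun x => ENNReal.ofReal (gaussianPDFReal 0 (σ ^ 2).toNNReal x)),
    lintegral_gaussianPDFReal_eq_one _ hv, mul_one]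

/-! ### Tensorization of the divergence -/

theorem lintegral_pi_prod {ι : Type*} [Fintype ι] {E : Type*} [MeasurableSpace E]
    (μ : ι → Measure E) [∀ i, IsProbabilityMeasure (μ i)] {h : ι → E → ENNReal}
    (hh : ∀ i, Measurable (h i)) :
    ∫⁻ x, ∏ i, h i (x i) ∂(Measure.pi μ) = ∏ i, ∫⁻ x, h i x ∂(μ i) := by
  rw [lintegral_prod_eq_prod_lintegral_of_indepFun Finset.univ _
    (iIndepFun_pi fun i => (hh i).aemeasurable) fun i => (hh i).comp (measurable_pi_apply i)]
  exact Finset.prod_congr rfl fun i _ => (measurePreserving_eval μ i).lintegral_comp (hh i)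

theorem pi_withDensity {ι : Type*} [Fintype ι] {E : Type*} [MeasurableSpace E]
    (μ : ι → Measure E) [∀ i, IsProbabilityMeasure (μ i)] {h : ι → E → ENNReal}
    (hh : ∀ i, Measurable (h i)) [∀ i, SigmaFinite ((μ i).withDensity (h i))] :
    Measure.pi (fun i => (μ i).withDensity (h i)) =
      (Measure.pi μ).withDensity fun x => ∏ i, h i (x i) := by
  refine (Measure.pi_eq fun s hs => ?_)
  rw [withDensity_apply _ (MeasurableSet.univ_pi hs), ← lintegral_indicator (.univ_pi hs)]
  have e : ∀ x : ι → E, (Set.univ.pi s).indicator (fun x => ∏ i, h i (x i)) x =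
      ∏ i, (s i).indicator (h i) (x i) := by
    intro x
    by_cases hx : x ∈ Set.univ.pi s
    · rw [Set.indicator_of_mem hx]
      exact Finset.prod_congr rfl fun i _ => (Set.indicator_of_mem (hx i trivial) _).symm
    · rw [Set.indicator_of_notMem hx]
      obtain ⟨i, hi⟩ : ∃ i, x i ∉ s i := by simpa [Set.mem_pi] using hx
      exact (Finset.prod_eq_zero (Finset.mem_univ i) (Set.indicator_of_notMem hi _)).symm
  simp_rw [e]
  rw [lintegral_pi_prod μ fun i => (hh i).indicator (hs i)]
  refine Finset.prod_congr rfl fun i _ => ?_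
  rw [lintegral_indicator (hs i), withDensity_apply _ (hs i)]

theorem renyiDiv_withDensity {E : Type*} [MeasurableSpace E] (a : ℝ) (Q : Measure E)
    [SigmaFinite Q] {h : E → ENNReal} (hh : Measurable h) :
    renyiDiv a (Q.withDensity h) Q =
      (((a - 1)⁻¹ : ℝ) : EReal) * ENNReal.log (∫⁻ x, h x ^ a ∂Q) := by
  rw [renyiDiv, if_pos (withDensity_absolutelyContinuous _ _)]
  congr 2
  exact lintegral_congr_ae <| (Measure.rnDeriv_withDensity Q hh).mono fun x hx => by simp only [hx]

theorem mixLaw_eq_withDensity (q : unitInterval) {σ : ℝ} (hσ : 0 < σ) (ys zs : List ℝ) :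
    mixLaw q σ ys = (mixLaw q σ zs).withDensity
      fun x => ENNReal.ofReal (mixDensity q σ ys x / mixDensity q σ zs x) := by
  have hy := measurable_mixDensity q σ ys
  have hz := measurable_mixDensity q σ zs
  have hz0 := mixDensity_pos hσ q.2.1 q.2.2 zs
  rw [mixLaw, mixLaw, ← withDensity_mul _ (by fun_prop) (by fun_prop)]
  congr 1
  funext x
  rw [Pi.mul_apply, ← ENNReal.ofReal_mul (hz0 x).le, mul_div_cancel₀ _ (hz0 x).ne']

theorem lintegral_mixLaw_pow {α : ℕ} (hα : 1 ≤ α) (q : unitInterval) {σ : ℝ} (hσ : 0 < σ)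
    (ys zs : List ℝ) :
    ∫⁻ x, ENNReal.ofReal (mixDensity q σ ys x / mixDensity q σ zs x) ^ (α : ℝ) ∂(mixLaw q σ zs) =
      renyiMoment α (mixDensity q σ ys) (mixDensity q σ zs) := by
  obtain ⟨n, rfl⟩ := Nat.exists_eq_add_of_le' hα
  have hy := measurable_mixDensity q σ ys
  have hz := measurable_mixDensity q σ zs
  have hy0 := mixDensity_pos hσ q.2.1 q.2.2 ys
  have hz0 := mixDensity_pos hσ q.2.1 q.2.2 zs
  rw [mixLaw, lintegral_withDensity_eq_lintegral_mul _ (by fun_prop) (by fun_prop), renyiMoment]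
  refine lintegral_congr fun x => ?_
  rw [Pi.mul_apply, ENNReal.rpow_natCast, ← ENNReal.ofReal_pow (div_pos (hy0 x) (hz0 x)).le,
    ← ENNReal.ofReal_mul (hz0 x).le, Nat.add_sub_cancel]
  congr 1
  have := (hz0 x).ne'
  rw [div_pow]
  field_simp
  ring

theorem renyiDiv_aggregateCS {α : ℕ} (hα : 1 ≤ α) {d : ℕ} (q : unitInterval) {σ : ℝ} (hσ : 0 < σ)
    (Y Z : List (Fin d → ℝ)) :
    renyiDiv α (aggregateCS q σ Y) (aggregateCS q σ Z) =
      ((((α : ℝ) - 1)⁻¹ : ℝ) : EReal) * ENNReal.log (∏ l, renyiMoment α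
        (mixDensity q σ (Y.map fun y => y l)) (mixDensity q σ (Z.map fun z => z l))) := by
  have hp := isProbabilityMeasure_mixLaw q hσ
  have hm := measurable_mixDensity q σ
  have hc : ∀ l : Fin d, SigmaFinite ((mixLaw q σ (Z.map fun z => z l)).withDensity fun x =>
      ENNReal.ofReal (mixDensity q σ (Y.map fun y => y l) x /
        mixDensity q σ (Z.map fun z => z l) x)) := by
    intro l
    rw [← mixLaw_eq_withDensity q hσ]
    infer_instance
  have hr : ∀ ys zs : List ℝ, Measurable fun x =>
      ENNReal.ofReal (mixDensity q σ ys x / mixDensity q σ zs x) := fun ys zs =>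
    ((hm ys).div (hm zs)).ennreal_ofReal
  rw [aggregateCS_eq_pi q hσ, aggregateCS_eq_pi q hσ]
  -- Only the first law is rewritten, as a density with respect to the second, so that the product
  -- density is the likelihood ratio.
  conv_lhs =>
    enter [2, 1, l]
    rw [mixLaw_eq_withDensity q hσ _ (Z.map fun z => z l)]
  have hprod : Measurable fun x : Fin d → ℝ => ∏ l,
      ENNReal.ofReal (mixDensity q σ (Y.map fun y => y l) (x l) /
        mixDensity q σ (Z.map fun z => z l) (x l)) :=
    Finset.measurable_prod _ fun l _ => (hr _ _).comp (measurable_pi_apply l)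
  rw [pi_withDensity _ fun l => hr _ _, renyiDiv_withDensity _ _ hprod]
  congr 2
  rw [← Finset.prod_congr rfl fun l _ => lintegral_mixLaw_pow hα q hσ _ _,
    ← lintegral_pi_prod _ fun l => (hr _ _).pow_const _]
  refine lintegral_congr fun x => ?_
  exact (ENNReal.prod_rpow_of_nonneg (Nat.cast_nonneg α)).symm

theorem aggregateCS_perm {d : ℕ} (q : unitInterval) {σ : ℝ} (hσ : 0 < σ)
    {Y Z : List (Fin d → ℝ)} (h : Y.Perm Z) : aggregateCS q σ Y = aggregateCS q σ Z := by
  rw [aggregateCS_eq_pi q hσ, aggregateCS_eq_pi q hσ]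
  congr 1
  funext l
  rw [mixLaw, mixDensity_perm (h.map _), mixLaw]

/-! ### Privacy loss of a vector -/

/-- The Rényi divergence of order `α` that a differing vector `s` causes on the empty dataset. -/
def vectorLoss {d : ℕ} (α : ℕ) (q σ : ℝ) (s : Fin d → ℝ) : ℝ :=
  ((α : ℝ) - 1)⁻¹ * ∑ l, Real.log (subsampledMoment α q σ (s l))

theorem sum_binomial_weight (α : ℕ) (q : ℝ) :
    ∑ v ∈ Finset.range (α + 1), (α.choose v : ℝ) * (1 - q) ^ (α - v) * q ^ v = 1 := by
  calc _ = (q + (1 - q)) ^ α := by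
        rw [add_pow]
        exact Finset.sum_congr rfl fun v _ => by ring
    _ = 1 := by simp

theorem natCast_mul_sub_one_nonneg (v : ℕ) : 0 ≤ (v : ℝ) * ((v : ℝ) - 1) := by
  rcases v with _ | v
  · simp
  · push_cast
    rw [add_sub_cancel_right]
    positivity

theorem one_le_subsampledMoment {α : ℕ} {q : ℝ} (σ : ℝ) (h0 : 0 ≤ q) (h1 : q ≤ 1) (s : ℝ) :
    1 ≤ subsampledMoment α q σ s := by
  have h1' : 0 ≤ 1 - q := sub_nonneg.2 h1
  rw [← sum_binomial_weight α q]
  refine Finset.sum_le_sum fun v _ => le_mul_of_one_le_right (by positivity) ?_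
  exact Real.one_le_exp (div_nonneg (mul_nonneg (natCast_mul_sub_one_nonneg v) (sq_nonneg _))
    (by positivity))

theorem vectorLoss_eq_renyiDiv {α : ℕ} (hα : 2 ≤ α) {d : ℕ} (q : unitInterval) {σ : ℝ}
    (hσ : 0 < σ) (s : Fin d → ℝ) :
    renyiDiv α (aggregateCS q σ [s]) (aggregateCS q σ []) = (vectorLoss α q σ s : EReal) := by
  rw [renyiDiv_aggregateCS (by omega) q hσ]
  have hp : ∀ l, 0 < subsampledMoment α q σ (s l) := fun l =>
    zero_lt_one.trans_le (one_le_subsampledMoment σ q.2.1 q.2.2 _)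
  simp only [List.map_cons, List.map_nil,
    renyiMoment_singleton_nil_eq (α := α) (by omega) hσ q.2.1 q.2.2]
  rw [← ENNReal.ofReal_prod_of_nonneg fun l _ => (hp l).le,
    ENNReal.log_ofReal_of_pos (Finset.prod_pos fun l _ => hp l),
    Real.log_prod fun l _ => (hp l).ne', ← EReal.coe_mul]
  rfl

theorem renyiDiv_le_vectorLoss {α : ℕ} (hα : 2 ≤ α) {d : ℕ} (q : unitInterval) {σ : ℝ}
    {s : Fin d → ℝ} {Y Z : List (Fin d → ℝ)} (hσ : 0 < σ)
    (h : ∀ l, renyiMoment α (mixDensity q σ (Y.map fun y => y l))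
      (mixDensity q σ (Z.map fun z => z l)) ≤
        renyiMoment α (mixDensity q σ [s l]) (mixDensity q σ [])) :
    renyiDiv α (aggregateCS q σ Y) (aggregateCS q σ Z) ≤ (vectorLoss α q σ s : EReal) := by
  rw [← vectorLoss_eq_renyiDiv hα q hσ s, renyiDiv_aggregateCS (by omega) q hσ,
    renyiDiv_aggregateCS (by omega) q hσ]
  have hα' : (0 : ℝ) ≤ ((α : ℝ) - 1)⁻¹ := by
    have : (2 : ℝ) ≤ α := by exact_mod_cast hα
    exact inv_nonneg.2 (by linarith)
  exact mul_le_mul_of_nonneg_left (ENNReal.log_monotone (Finset.prod_le_prod' fun l _ => h l))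
    (EReal.coe_nonneg.2 hα')

theorem renyiDiv_insert_le {α : ℕ} (hα : 2 ≤ α) {d : ℕ} (q : unitInterval) {σ : ℝ}
    (hσ : 0 < σ) (s : Fin d → ℝ) (Y : List (Fin d → ℝ)) :
    renyiDiv α (aggregateCS q σ (s :: Y)) (aggregateCS q σ Y) ≤ (vectorLoss α q σ s : EReal) :=
  renyiDiv_le_vectorLoss hα q hσ fun _ =>
    renyiMoment_insert_le (by omega) hσ q.2.1 q.2.2 _ _

theorem renyiDiv_remove_le {α : ℕ} (hα : 2 ≤ α) {d : ℕ} (q : unitInterval) {σ : ℝ}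
    (hσ : 0 < σ) (s : Fin d → ℝ) (Y : List (Fin d → ℝ)) :
    renyiDiv α (aggregateCS q σ Y) (aggregateCS q σ (s :: Y)) ≤ (vectorLoss α q σ s : EReal) :=
  renyiDiv_le_vectorLoss hα q hσ fun _ =>
    (renyiMoment_remove_le (by omega) hσ q.2.1 q.2.2 _ _).trans
      (renyiMoment_nil_singleton_le (by omega) hσ q.2.1 q.2.2 _)

/-- The supremum is attained at the empty dataset in the insertion direction, so `S` plays no role.
-/
theorem privacyLoss_eq_vectorLoss {α : ℕ} (hα : 2 ≤ α) {d : ℕ} (q : unitInterval) {σ : ℝ}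
    (hσ : 0 < σ) (S : Set (Fin d → ℝ)) (s : Fin d → ℝ) :
    privacyLoss q σ α S s = (vectorLoss α q σ s : EReal) := by
  refine le_antisymm (iSup₂_le fun Y _ =>
    max_le (renyiDiv_insert_le hα q hσ s Y) (renyiDiv_remove_le hα q hσ s Y)) ?_
  rw [← vectorLoss_eq_renyiDiv hα q hσ s]
  refine le_iSup₂_of_le [] (by simp) (le_max_left _ _)

/-! ### Growth of the moment in the shift -/

theorem subsampledMoment_abs (α : ℕ) (q σ s : ℝ) :
    subsampledMoment α q σ |s| = subsampledMoment α q σ s := by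
  simp only [subsampledMoment, sq_abs]

theorem subsampledMoment_zero (α : ℕ) (q σ : ℝ) : subsampledMoment α q σ 0 = 1 := by
  simpa [subsampledMoment] using sum_binomial_weight α q

theorem one_lt_subsampledMoment {α : ℕ} (hα : 2 ≤ α) {q σ c : ℝ} (hσ : 0 < σ) (h0 : 0 < q)
    (h1 : q ≤ 1) (hc : 0 < c) : 1 < subsampledMoment α q σ c := by
  have h1' : 0 ≤ 1 - q := sub_nonneg.2 h1
  rw [← sum_binomial_weight α q]
  refine Finset.sum_lt_sum (fun v _ => le_mul_of_one_le_right (by positivity) ?_)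
    -- The term `v = α` has weight `q ^ α`, positive even when `q = 1`.
    ⟨α, Finset.self_mem_range_succ α, ?_⟩
  · exact Real.one_le_exp (div_nonneg (mul_nonneg (natCast_mul_sub_one_nonneg v) (sq_nonneg _))
      (by positivity))
  · have : (2 : ℝ) ≤ α := by exact_mod_cast hα
    have : 0 < (α : ℝ) - 1 := by linarith
    simp only [Nat.choose_self, Nat.sub_self, pow_zero, Nat.cast_one, one_mul]
    refine lt_mul_of_one_lt_right (by positivity) (Real.one_lt_exp_iff.2 (by positivity))

theorem exp_mul_sq_div_rpow (b σ t c θ : ℝ) (h : t ^ 2 = θ * c ^ 2) :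
    Real.exp (b * t ^ 2 / (2 * σ ^ 2)) = Real.exp (b * c ^ 2 / (2 * σ ^ 2)) ^ θ := by
  rw [← Real.exp_mul, h]
  ring_nf

theorem subsampledMoment_le_rpow {α : ℕ} {q σ t c θ : ℝ} (h0 : 0 ≤ q) (h1 : q ≤ 1)
    (hθ0 : 0 ≤ θ) (hθ1 : θ ≤ 1) (h : t ^ 2 = θ * c ^ 2) :
    subsampledMoment α q σ t ≤ subsampledMoment α q σ c ^ θ := by
  have h1' : 0 ≤ 1 - q := sub_nonneg.2 h1
  have := (Real.concaveOn_rpow hθ0 hθ1).le_map_sum (t := Finset.range (α + 1))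
    (w := fun v => (α.choose v : ℝ) * (1 - q) ^ (α - v) * q ^ v)
    (p := fun v => Real.exp ((v : ℝ) * ((v : ℝ) - 1) * c ^ 2 / (2 * σ ^ 2)))
    (fun v _ => by positivity) (sum_binomial_weight α q) fun v _ => (Real.exp_pos _).le
  simp only [smul_eq_mul, ← exp_mul_sq_div_rpow _ σ t c θ h] at this
  exact this

theorem subsampledMoment_lt_rpow {α : ℕ} (hα : 2 ≤ α) {q σ t c θ : ℝ} (hσ : 0 < σ) (h0 : 0 < q)
    (h1 : q < 1) (hc : 0 < c) (hθ0 : 0 < θ) (hθ1 : θ < 1) (h : t ^ 2 = θ * c ^ 2) :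
    subsampledMoment α q σ t < subsampledMoment α q σ c ^ θ := by
  have h1' : 0 < 1 - q := sub_pos.2 h1
  have := (Real.strictConcaveOn_rpow hθ0 hθ1).lt_map_sum (t := Finset.range (α + 1))
    (w := fun v => (α.choose v : ℝ) * (1 - q) ^ (α - v) * q ^ v)
    (p := fun v => Real.exp ((v : ℝ) * ((v : ℝ) - 1) * c ^ 2 / (2 * σ ^ 2)))
    (fun v hv => by
      have := Nat.choose_pos (Nat.lt_succ_iff.1 (Finset.mem_range.1 hv))
      positivity) (sum_binomial_weight α q) (fun v _ => (Real.exp_pos _).le)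
    -- Strict Jensen needs two distinct values. The exponent vanishes for `v = 0` and `v = 1`, so `v
    -- = 2` is the first that differs; hence `2 ≤ α`.
    ⟨0, by simp, 2, by simp; omega, by
      refine (Real.exp_lt_exp.2 ?_).ne
      norm_num
      positivity⟩
  simp only [smul_eq_mul, ← exp_mul_sq_div_rpow _ σ t c θ h] at this
  exact this

theorem log_subsampledMoment_le {α : ℕ} {q σ t c p : ℝ} (h0 : 0 ≤ q) (h1 : q ≤ 1)
    (hc : 0 < c) (hp0 : 0 < p) (hp2 : p ≤ 2) (ht : |t| ≤ c) :
    Real.log (subsampledMoment α q σ t) ≤ (|t| / c) ^ p * Real.log (subsampledMoment α q σ c) := by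
  have hu0 : 0 ≤ |t| / c := by positivity
  have hu1 : |t| / c ≤ 1 := (div_le_one hc).2 ht
  have hM := one_le_subsampledMoment (α := α) σ h0 h1
  have hlog := Real.log_nonneg (hM c)
  have h2 : (|t| / c) ^ 2 ≤ (|t| / c) ^ p := by
    rw [← Real.rpow_two]
    exact Real.rpow_le_rpow_of_exponent_ge' hu0 hu1 hp0.le hp2
  refine le_trans ?_ (mul_le_mul_of_nonneg_right h2 hlog)
  rw [← Real.log_rpow (by linarith [hM c])]
  refine Real.log_le_log (by linarith [hM t]) (subsampledMoment_le_rpow h0 h1 (sq_nonneg _)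
    (pow_le_one₀ hu0 hu1) ?_)
  rw [div_pow, sq_abs, div_mul_cancel₀ _ (by positivity)]

/-- Strictness comes from Jensen if `q < 1` and from comparing exponents if `p < 2`. For `q = 1`, `p
= 2` the logarithm is proportional to `t ^ 2` and equality holds throughout. -/
theorem log_subsampledMoment_lt {α : ℕ} (hα : 2 ≤ α) {q σ t c p : ℝ} (hσ : 0 < σ) (h0 : 0 < q)
    (h1 : q ≤ 1) (hp0 : 0 < p) (hp2 : p ≤ 2) (hqp : q < 1 ∨ p < 2) (ht0 : t ≠ 0) (ht : |t| < c) :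
    Real.log (subsampledMoment α q σ t) < (|t| / c) ^ p * Real.log (subsampledMoment α q σ c) := by
  have ht0' := abs_pos.2 ht0
  have hc : 0 < c := ht0'.trans ht
  have hu0 : 0 < |t| / c := by positivity
  have hu1 : |t| / c < 1 := (div_lt_one hc).2 ht
  have hM := one_le_subsampledMoment (α := α) σ h0.le h1
  have hlog := Real.log_pos (one_lt_subsampledMoment hα hσ h0 h1 hc)
  rcases hqp with hq | hp
  · have h2 : (|t| / c) ^ 2 ≤ (|t| / c) ^ p := by
      rw [← Real.rpow_two]
      exact Real.rpow_le_rpow_of_exponent_ge' hu0.le hu1.le hp0.le hp2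
    refine lt_of_lt_of_le ?_ (mul_le_mul_of_nonneg_right h2 hlog.le)
    rw [← Real.log_rpow (by linarith [hM c])]
    refine Real.log_lt_log (by linarith [hM t]) (subsampledMoment_lt_rpow hα hσ h0 hq hc
      (by positivity) (pow_lt_one₀ hu0.le hu1 two_ne_zero) ?_)
    rw [div_pow, sq_abs, div_mul_cancel₀ _ (by positivity)]
  · refine (log_subsampledMoment_le h0.le h1 hc two_pos le_rfl ht.le).trans_lt ?_
    exact mul_lt_mul_of_pos_right (Real.rpow_lt_rpow_of_exponent_gt hu0 hu1 hp) hlog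

/-! ### Spike vectors as the maximizers under mixed clipping -/

theorem card_filter_val_lt {d k : ℕ} (hk : k ≤ d) :
    (Finset.univ.filter fun l : Fin d => (l : ℕ) < k).card = k := by
  simp [Fin.card_filter_val_lt, hk]

theorem IsSpikeForm.sum_comp_abs {d d₀ : ℕ} (hd : d₀ ≤ d) {c : ℝ} {s : Fin d → ℝ}
    (hs : IsSpikeForm d₀ c s) {g : ℝ → ℝ} (hg : g 0 = 0) : ∑ l, g |s l| = d₀ * g c := by
  obtain ⟨π, hπ⟩ := hs
  simp_rw [hπ]
  rw [Equiv.sum_comp π fun l => g (spikeVector d d₀ c l)]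
  simp only [spikeVector, apply_ite g, hg]
  rw [Finset.sum_ite, Finset.sum_const_zero, add_zero, Finset.sum_const, nsmul_eq_mul]
  rw [card_filter_val_lt hd]

theorem isSpikeForm_spikeVector (d d₀ : ℕ) {c : ℝ} (hc : 0 ≤ c) :
    IsSpikeForm d₀ c (spikeVector d d₀ c) := by
  refine ⟨1, fun l => ?_⟩
  refine abs_of_nonneg ?_
  unfold spikeVector
  split_ifs
  exacts [hc, le_rfl]

/-- A bijection from the positions of `c` to the first `d₀` indices extends to a permutation. -/
theorem isSpikeForm_of_card {d d₀ : ℕ} (hd : d₀ ≤ d) {c : ℝ} {s : Fin d → ℝ}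
    (h : ∀ l, |s l| = 0 ∨ |s l| = c)
    (hcard : (Finset.univ.filter fun l => |s l| = c).card = d₀) : IsSpikeForm d₀ c s := by
  classical
  have e : Fintype.card {l : Fin d // |s l| = c} = Fintype.card {l : Fin d // (l : ℕ) < d₀} := by
    rw [Fintype.card_subtype, Fintype.card_subtype, hcard, card_filter_val_lt hd]
  let e' := Fintype.equivOfCardEq e
  refine ⟨e'.extendSubtype, fun l => ?_⟩
  by_cases hl : |s l| = c
  · rw [spikeVector, if_pos (e'.extendSubtype_mem l hl), hl]
  · rw [spikeVector, if_neg (e'.extendSubtype_not_mem l hl), (h l).resolve_right hl]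

theorem sum_rpow_le_of_mem_mixedBall {d d₀ : ℕ} {p cp c : ℝ} (hp0 : 0 < p)
    (hclip : (d₀ : ℝ) * c ^ p = cp ^ p) {s : Fin d → ℝ} (hs : s ∈ mixedBall d p cp c) :
    ∑ l, |s l| ^ p ≤ d₀ * c ^ p := by
  have h0 : 0 ≤ ∑ l, |s l| ^ p := Finset.sum_nonneg fun l _ => by positivity
  have := Real.rpow_le_rpow (by positivity) hs.1 hp0.le
  rwa [← Real.rpow_mul h0, one_div_mul_cancel hp0.ne', Real.rpow_one, ← hclip] at this

theorem IsSpikeForm.mem_mixedBall {d d₀ : ℕ} (hd : d₀ ≤ d) {p cp c : ℝ} (hp0 : 0 < p)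
    (hcp : 0 ≤ cp) (hc : 0 ≤ c) (hclip : (d₀ : ℝ) * c ^ p = cp ^ p) {s : Fin d → ℝ}
    (hs : IsSpikeForm d₀ c s) : s ∈ mixedBall d p cp c := by
  constructor
  · rw [hs.sum_comp_abs hd (g := fun x => x ^ p) (Real.zero_rpow hp0.ne'), hclip,
      ← Real.rpow_mul hcp, mul_one_div_cancel hp0.ne', Real.rpow_one]
  · obtain ⟨π, hπ⟩ := hs
    intro l
    rw [hπ, spikeVector]
    split_ifs
    exacts [le_rfl, hc]

theorem closedFormRDP_eq (d₀ α : ℕ) (q σ c : ℝ) :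
    closedFormRDP d₀ α q σ c =
      ((α : ℝ) - 1)⁻¹ * (d₀ * Real.log (subsampledMoment α q σ c)) := by
  have e : Finset.Icc 1 α = Finset.Ico 1 (α + 1) := by
    ext v
    simp only [Finset.mem_Icc, Finset.mem_Ico]
    omega
  rw [closedFormRDP, subsampledMoment, Finset.range_eq_Ico,
    Finset.sum_eq_sum_Ico_succ_bot (Nat.succ_pos α), e]
  simp
  ring

theorem IsSpikeForm.vectorLoss_eq {d d₀ : ℕ} (hd : d₀ ≤ d) (α : ℕ) (q σ : ℝ) {c : ℝ}
    {s : Fin d → ℝ} (hs : IsSpikeForm d₀ c s) :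
    vectorLoss α q σ s = closedFormRDP d₀ α q σ c := by
  rw [closedFormRDP_eq, vectorLoss, ← hs.sum_comp_abs hd
    (g := fun x => Real.log (subsampledMoment α q σ x)) (by simp [subsampledMoment_zero])]
  simp only [subsampledMoment_abs]

theorem sum_log_subsampledMoment_le {d d₀ α : ℕ} {p cp c q σ : ℝ} (h0 : 0 ≤ q) (h1 : q ≤ 1)
    (hp0 : 0 < p) (hc : 0 < c) (hclip : (d₀ : ℝ) * c ^ p = cp ^ p) {s : Fin d → ℝ}
    (hs : s ∈ mixedBall d p cp c) :
    ∑ l, (|s l| / c) ^ p * Real.log (subsampledMoment α q σ c) ≤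
      d₀ * Real.log (subsampledMoment α q σ c) := by
  have hlog := Real.log_nonneg (one_le_subsampledMoment (α := α) σ h0 h1 c)
  rw [← Finset.sum_mul]
  refine mul_le_mul_of_nonneg_right ?_ hlog
  simp_rw [Real.div_rpow (abs_nonneg _) hc.le]
  rw [← Finset.sum_div, div_le_iff₀ (by positivity)]
  exact sum_rpow_le_of_mem_mixedBall hp0 hclip hs

theorem vectorLoss_le {d d₀ α : ℕ} (hα : 2 ≤ α) {p cp c q σ : ℝ} (h0 : 0 ≤ q) (h1 : q ≤ 1)
    (hp0 : 0 < p) (hp2 : p ≤ 2) (hc : 0 ≤ c) (hclip : (d₀ : ℝ) * c ^ p = cp ^ p) {s : Fin d → ℝ}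
    (hs : s ∈ mixedBall d p cp c) : vectorLoss α q σ s ≤ closedFormRDP d₀ α q σ c := by
  have hα' : (2 : ℝ) ≤ α := by exact_mod_cast hα
  rw [closedFormRDP_eq, vectorLoss]
  refine mul_le_mul_of_nonneg_left ?_ (inv_nonneg.2 (by linarith))
  rcases hc.eq_or_lt with rfl | hc
  · have : ∀ l, s l = 0 := fun l => abs_nonpos_iff.1 (hs.2 l)
    simp [this, subsampledMoment_zero]
  · exact (Finset.sum_le_sum fun l _ => log_subsampledMoment_le h0 h1 hc hp0 hp2 (hs.2 l)).trans
      (sum_log_subsampledMoment_le h0 h1 hp0 hc hclip hs)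

/-- A maximizer has equality in every coordinate bound, so no `|s l|` lies strictly between `0` and
`c`; the total then counts the entries equal to `c`. -/
theorem isSpikeForm_of_vectorLoss {d d₀ α : ℕ} (hd : d₀ ≤ d) (hα : 2 ≤ α) {p cp c q σ : ℝ}
    (hσ : 0 < σ) (h0 : 0 < q) (h1 : q ≤ 1) (hp0 : 0 < p) (hp2 : p ≤ 2) (hqp : q < 1 ∨ p < 2)
    (hc : 0 ≤ c) (hclip : (d₀ : ℝ) * c ^ p = cp ^ p) {s : Fin d → ℝ}
    (hs : s ∈ mixedBall d p cp c) (h : closedFormRDP d₀ α q σ c ≤ vectorLoss α q σ s) :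
    IsSpikeForm d₀ c s := by
  rcases hc.eq_or_lt with rfl | hc
  · exact ⟨1, fun l => by
      rw [abs_nonpos_iff.1 (hs.2 l), abs_zero, spikeVector, ite_self]⟩
  have hα' : (2 : ℝ) ≤ α := by exact_mod_cast hα
  rw [closedFormRDP_eq, vectorLoss,
    mul_le_mul_iff_of_pos_left (inv_pos.2 (by linarith : (0 : ℝ) < α - 1))] at h
  have hlog := Real.log_pos (one_lt_subsampledMoment hα hσ h0 h1 hc)
  have hle : ∀ l ∈ Finset.univ, Real.log (subsampledMoment α q σ (s l)) ≤
      (|s l| / c) ^ p * Real.log (subsampledMoment α q σ c) := fun l _ =>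
    log_subsampledMoment_le h0.le h1 hc hp0 hp2 (hs.2 l)
  have hsum := sum_log_subsampledMoment_le (α := α) (σ := σ) h0.le h1 hp0 hc hclip hs
  have heq := (Finset.sum_eq_sum_iff_of_le hle).1
    (le_antisymm (Finset.sum_le_sum hle) (hsum.trans h))
  have hval : ∀ l, |s l| = 0 ∨ |s l| = c := by
    intro l
    by_contra! hl
    exact (log_subsampledMoment_lt hα hσ h0 h1 hp0 hp2 hqp (abs_ne_zero.1 hl.1)
      (lt_of_le_of_ne (hs.2 l) hl.2)).ne (heq l (Finset.mem_univ l))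
  refine isSpikeForm_of_card hd hval ?_
  have hterm : ∀ l, Real.log (subsampledMoment α q σ (s l)) =
      if |s l| = c then Real.log (subsampledMoment α q σ c) else 0 := by
    intro l
    rw [← subsampledMoment_abs]
    split_ifs with hl
    · rw [hl]
    · rw [(hval l).resolve_right hl, subsampledMoment_zero, Real.log_one]
  have htot := le_antisymm ((Finset.sum_le_sum hle).trans hsum) h
  simp_rw [hterm] at htot
  rw [Finset.sum_ite, Finset.sum_const_zero, add_zero, Finset.sum_const, nsmul_eq_mul] at htot
  exact_mod_cast mul_right_cancel₀ hlog.ne' htot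

/-! ### Rényi differential privacy and optimality -/

theorem isRDP_coordinateSampling {α : ℕ} (hα : 2 ≤ α) {d : ℕ} (q : unitInterval) {σ : ℝ}
    (hσ : 0 < σ) {𝒳 : Type*} (F : 𝒳 → Fin d → ℝ) (clip : (Fin d → ℝ) → (Fin d → ℝ)) {ε : ℝ}
    (h : ∀ x, vectorLoss α q σ (clip (F x)) ≤ ε) :
    IsRDP (coordinateSampling F clip q σ) α ε := by
  rintro X X' (⟨x, hx⟩ | ⟨x, hx⟩)
  · rw [coordinateSampling, coordinateSampling, aggregateCS_perm q hσ (hx.map _)]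
    exact (renyiDiv_remove_le hα q hσ _ _).trans (EReal.coe_le_coe_iff.2 (h x))
  · rw [coordinateSampling, coordinateSampling, aggregateCS_perm q hσ (hx.map _)]
    exact (renyiDiv_insert_le hα q hσ _ _).trans (EReal.coe_le_coe_iff.2 (h x))

theorem vectorLoss_le_of_isRDP {α : ℕ} (hα : 2 ≤ α) {d : ℕ} {q : unitInterval} {σ : ℝ}
    (hσ : 0 < σ) {𝒳 : Type*} {F : 𝒳 → Fin d → ℝ} {clip : (Fin d → ℝ) → (Fin d → ℝ)} {ε : ℝ}
    (h : IsRDP (coordinateSampling F clip q σ) α ε) (x : 𝒳) :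
    vectorLoss α q σ (clip (F x)) ≤ ε := by
  -- The singleton and the empty dataset already attain the loss of the clipped point.
  have := h [x] [] (Or.inr ⟨x, List.Perm.refl _⟩)
  rw [coordinateSampling, coordinateSampling, List.map_cons, List.map_nil,
    vectorLoss_eq_renyiDiv hα q hσ] at this
  exact EReal.coe_le_coe_iff.1 this

end

theorem theorem4 {d : ℕ} (d₀ : ℕ) (hd : d₀ ≤ d)
    (p : ℝ) (hp0 : 0 < p) (hp2 : p ≤ 2)
    (cp c : ℝ) (hcp : 0 ≤ cp) (hc : 0 ≤ c) (hclip : (d₀ : ℝ) * c ^ p = cp ^ p)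
    (σ : ℝ) (hσ : 0 < σ) (q : unitInterval) (α : ℕ) (hα : 2 ≤ α) :
    -- the vector `(c, …, c, 0, …, 0)` is a dominating sensitivity
    IsDominating q σ α (mixedBall d p cp c) (spikeVector d d₀ c) ∧
    -- so are the vectors that differ from it by order and signs only
    (∀ s : Fin d → ℝ, IsSpikeForm d₀ c s → IsDominating q σ α (mixedBall d p cp c) s) ∧
    -- and, apart from degenerate sampling rates, there are no others
    (0 < (q : ℝ) → (q : ℝ) < 1 ∨ p < 2 →
      ∀ s : Fin d → ℝ, IsDominating q σ α (mixedBall d p cp c) s → IsSpikeForm d₀ c s) ∧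
    -- the maximal privacy loss is the closed form
    privacyLoss q σ α (mixedBall d p cp c) (spikeVector d d₀ c) =
      ((closedFormRDP d₀ α q σ c : ℝ) : EReal) ∧
    -- the algorithm is RDP with the closed form, which is optimal if a data point attains it
    (∀ (𝒳 : Type*) (F : 𝒳 → Fin d → ℝ) (clip : (Fin d → ℝ) → (Fin d → ℝ)),
      (∀ v, clip v ∈ mixedBall d p cp c) →
      IsRDP (coordinateSampling F clip q σ) α (closedFormRDP d₀ α q σ c) ∧
      ((∃ x, IsSpikeForm d₀ c (clip (F x))) →
        IsLeast {ε : ℝ | IsRDP (coordinateSampling F clip q σ) α ε}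
          (closedFormRDP d₀ α q σ c))) := by
  have hle : ∀ s ∈ mixedBall d p cp c, vectorLoss α q σ s ≤ closedFormRDP d₀ α q σ c := fun s hs =>
    vectorLoss_le hα q.2.1 q.2.2 hp0 hp2 hc hclip hs
  have hspike := isSpikeForm_spikeVector d d₀ hc
  have hdom : ∀ s : Fin d → ℝ, IsSpikeForm d₀ c s →
      IsDominating q σ α (mixedBall d p cp c) s := by
    intro s hs
    refine ⟨hs.mem_mixedBall hd hp0 hcp hc hclip, fun t ht => ?_⟩
    rw [privacyLoss_eq_vectorLoss hα q hσ, privacyLoss_eq_vectorLoss hα q hσ, hs.vectorLoss_eq hd]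
    exact EReal.coe_le_coe_iff.2 (hle t ht)
  refine ⟨hdom _ hspike, hdom, fun h0 hqp s hs => ?_, ?_, fun 𝒳 F clip hclipF => ?_⟩
  · have := hs.2 _ (hspike.mem_mixedBall hd hp0 hcp hc hclip)
    rw [privacyLoss_eq_vectorLoss hα q hσ, privacyLoss_eq_vectorLoss hα q hσ,
      hspike.vectorLoss_eq hd] at this
    exact isSpikeForm_of_vectorLoss hd hα hσ h0 q.2.2 hp0 hp2 hqp hc hclip hs.1
      (EReal.coe_le_coe_iff.1 this)
  · rw [privacyLoss_eq_vectorLoss hα q hσ, hspike.vectorLoss_eq hd]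
  · have hrdp := isRDP_coordinateSampling hα q hσ F clip fun x => hle _ (hclipF (F x))
    refine ⟨hrdp, fun ⟨x, hx⟩ => ⟨hrdp, fun ε hε => ?_⟩⟩
    rw [← hx.vectorLoss_eq hd α q σ]
    exact vectorLoss_le_of_isRDP hα hσ hε x
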